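/- Let $K$ be a field and let $A$ be an associative, not necessarily unital, $K$-algebra with product $m:A\otimes A\to A$. Let $\sigma$ be a braiding on $A$, that is, an invertible linear endomorphism of $A\otimes A$ with $\sigma_1\sigma_2\sigma_1=\sigma_2\sigma_1\sigma_2$ on $A^{\otimes 3}$, where $\sigma_k$ denotes $\sigma$ acting on the tensor factors $k,k+1$. Suppose that $(A,m,\sigma)$ is a braided algebra, i.e. $$(\mathrm{id}_A\otimes m)\sigma_1\sigma_2=\sigma(m\otimes\mathrm{id}_A),\qquad (m\otimes\mathrm{id}_A)\sigma_2\sigma_1=\sigma(\mathrm{id}_A\otimes m).$$ Let $T(A)=\bigoplus_{i\ge 0}A^{\otimes i}$. Put $\beta_{i,1}=\sigma_1\sigma_2\cdots\sigma_i:A^{\otimes i}\otimes A\to A\otimes A^{\otimes i}$, with $\beta_{0,1}=\mathrm{id}_A$. Let the quantum quasi-shuffle product $\bowtie$ be the bilinear product on $T(A)$ defined recursively by $1\bowtie x=x\bowtie 1=x$ and, for $a,b\in A$, $x\in A^{\otimes i}$, $y\in A^{\otimes j}$, $i,j\ge 0$, $$(a\otimes x)\bowtie(b\otimes y)=a\otimes\big(x\bowtie(b\otimes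 y)\big)+(\mathrm{id}_A\otimes\bowtie)(\beta_{i+1,1}\otimes\mathrm{id}_A^{\otimes j})(a\otimes x\otimes b\otimes y)+(m\otimes\bowtie)(\mathrm{id}_A\otimes\beta_{i,1}\otimes\mathrm{id}_A^{\otimes j})(a\otimes x\otimes b\otimes y).$$ Define three bilinear operations $\prec,\succ,\cdot$ on $T(A)$ by the three summands: for $a,b,x,y$ as above, $$(a\otimes x)\prec(b\otimes y)=a\otimes\big(x\bowtie(b\otimes y)\big),$$ $$(a\otimes x)\succ(b\otimes y)=(\mathrm{id}_A\otimes\bowtie)(\beta_{i+1,1}\otimes\mathrm{id}_A^{\otimes j})(a\otimes x\otimes b\otimes y),$$ $$(a\otimes x)\cdot(b\otimes y)=(m\otimes\bowtie)(\mathrm{id}_A\otimes\beta_{i,1}\otimes\mathrm{id}_A^{\otimes j})(a\otimes x\otimes b\otimes y),$$ and, if one of the arguments is the unit $1\in K=A^{\otimes 0}$, by $u\prec 1=u$, $1\prec u=0$, $1\succ u=u$, $u\succ 1=0$, $u\cdot 1=1\cdot u=0$ for $u\in\bigoplus_{i\ge 1}A^{\otimes i}$, together with $1\prec 1=1\succ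 1=0$ and $1\cdot 1=1$. Then $(T(A),\prec,\succ,\cdot)$ is a tridendriform algebra in the sense of Loday and Ronco: with $x\ast y=x\prec y+x\succ y+x\cdot y$, for all $x,y,z\in T(A)$, $$(x\prec y)\prec z=x\prec(y\ast z),\quad (x\succ y)\prec z=x\succ(y\prec z),\quad (x\ast y)\succ z=x\succ(y\succ z),$$ $$(x\succ y)\cdot z=x\succ(y\cdot z),\quad (x\prec y)\cdot z=x\cdot(y\succ z),\quad (x\cdot y)\prec z=x\cdot(y\prec z),\quad (x\cdot y)\cdot z=x\cdot(y\cdot z).$$ -/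

import Mathlib

open scoped TensorProduct

noncomputable section

namespace QuantumQuasiShuffle

section Tridendriform

variable {K V : Type*} [CommRing K] [AddCommGroup V] [Module K V]

/-- A tridendriform algebra structure (Loday-Ronco) on the `K`-module `V`: three bilinear
operations, here `p` for `≺`, `s` for `≻` and `d` for `·`, satisfying the seven relations
below, in which `x ∗ y = x ≺ y + x ≻ y + x · y`. -/
structure IsTridendriform (p s d : V →ₗ[K] V →ₗ[K] V) : Prop where
  prec_prec : ∀ x y z, p (p x y) z = p x (p y z + s y z + d y z)
  succ_prec : ∀ x y z, p (s x y) z = s x (p y z)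
  star_succ : ∀ x y z, s (p x y + s x y + d x y) z = s x (s y z)
  succ_dot : ∀ x y z, d (s x y) z = s x (d y z)
  prec_dot : ∀ x y z, d (p x y) z = d x (s y z)
  dot_prec : ∀ x y z, p (d x y) z = d x (p y z)
  dot_dot : ∀ x y z, d (d x y) z = d x (d y z)

end Tridendriform

section Braiding

variable {K A : Type*} [CommRing K]

/-- `σ₁ = σ ⊗ id`, acting on `A ⊗ (A ⊗ W)`. -/
def onFirstTwo [AddCommGroup A] [Module K A] (σ : A ⊗[K] A →ₗ[K] A ⊗[K] A)
    (W : Type*) [AddCommGroup W] [Module K W] :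
    A ⊗[K] (A ⊗[K] W) →ₗ[K] A ⊗[K] (A ⊗[K] W) :=
  (TensorProduct.assoc K A A W).toLinearMap ∘ₗ σ.rTensor W ∘ₗ
    (TensorProduct.assoc K A A W).symm.toLinearMap

/-- A braiding on `A`: an invertible linear endomorphism of `A ⊗ A` which satisfies the
quantum Yang-Baxter equation `σ₁ σ₂ σ₁ = σ₂ σ₁ σ₂` on `A ⊗ A ⊗ A`. -/
structure IsBraiding [AddCommGroup A] [Module K A] (σ : A ⊗[K] A →ₗ[K] A ⊗[K] A) :
    Prop where
  bijective : Function.Bijective σ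
  yang_baxter :
    onFirstTwo σ A ∘ₗ σ.lTensor A ∘ₗ onFirstTwo σ A =
      σ.lTensor A ∘ₗ onFirstTwo σ A ∘ₗ σ.lTensor A

/-- `(A, m, σ)` is a braided algebra, where `m` is the product of the associative, not
necessarily unital, algebra `A`: `σ` is a braiding, `(id ⊗ m) σ₁ σ₂ = σ (m ⊗ id)` and
`(m ⊗ id) σ₂ σ₁ = σ (id ⊗ m)`. -/
structure IsBraidedAlgebra [NonUnitalRing A] [Module K A] [IsScalarTower K A A]
    [SMulCommClass K A A] (σ : A ⊗[K] A →ₗ[K] A ⊗[K] A) : Prop extends IsBraiding σ where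
  mul_left :
    (LinearMap.mul' K A).lTensor A ∘ₗ onFirstTwo σ A ∘ₗ σ.lTensor A =
      σ ∘ₗ (LinearMap.mul' K A).rTensor A ∘ₗ (TensorProduct.assoc K A A A).symm.toLinearMap
  mul_right :
    (LinearMap.mul' K A).rTensor A ∘ₗ (TensorProduct.assoc K A A A).symm.toLinearMap ∘ₗ
        σ.lTensor A ∘ₗ onFirstTwo σ A =
      σ ∘ₗ (LinearMap.mul' K A).lTensor A

end Braiding

section FirstLetter

variable {K A M : Type*} [CommRing K] [AddCommGroup A] [Module K A]
  [AddCommGroup M] [Module K M]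

/-- The endomorphism `(x, v) ↦ (a ⊗ x, step a (x, v))` of `T(A) × M`. -/
def leftRecStep (step : A →ₗ[K] (TensorAlgebra K A × M) →ₗ[K] M) :
    A →ₗ[K] Module.End K (TensorAlgebra K A × M) :=
  LinearMap.mk₂ K
    (fun a p => ((TensorAlgebra.ι K a * p.1, step a p) : TensorAlgebra K A × M))
    (by intro a a' p; simp [add_mul])
    (by intro c a p; simp)
    (by intro a p p'; simp [mul_add])
    (by intro c a p; simp)

/-- Recursion on the first letter: the linear map `f` on `T(A)` determined by `f 1 = base`
and `f (a ⊗ x) = step a (x, f x)`. -/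
def leftRec (base : M) (step : A →ₗ[K] (TensorAlgebra K A × M) →ₗ[K] M) :
    TensorAlgebra K A →ₗ[K] M :=
  LinearMap.snd K (TensorAlgebra K A) M ∘ₗ
    (TensorAlgebra.lift K (leftRecStep step)).toLinearMap.flip (1, base)

theorem leftRec_one (base : M) (step : A →ₗ[K] (TensorAlgebra K A × M) →ₗ[K] M) :
    leftRec base step 1 = base := by
  simp [leftRec]

theorem leftRec_fst (step : A →ₗ[K] (TensorAlgebra K A × M) →ₗ[K] M)
    (x : TensorAlgebra K A) (p : TensorAlgebra K A × M) :
    (TensorAlgebra.lift K (leftRecStep step) x p).1 = x * p.1 := by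
  induction x using TensorAlgebra.induction generalizing p with
  | algebraMap r => simp [Algebra.smul_def]
  | ι a => simp [leftRecStep]
  | mul x y hx hy => simp [hx, hy, mul_assoc]
  | add x y hx hy => simp [hx, hy, add_mul]

theorem leftRec_ι_mul (base : M) (step : A →ₗ[K] (TensorAlgebra K A × M) →ₗ[K] M)
    (a : A) (x : TensorAlgebra K A) :
    leftRec base step (TensorAlgebra.ι K a * x) = step a (x, leftRec base step x) := by
  have h := leftRec_fst step x (1, base)
  simp only [leftRec, LinearMap.comp_apply, LinearMap.flip_apply, AlgHom.toLinearMap_apply,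
    LinearMap.snd_apply, map_mul, TensorAlgebra.lift_ι_apply, Module.End.mul_apply]
  rw [mul_one] at h
  simp only [leftRecStep, LinearMap.mk₂_apply]
  congr 1
  exact Prod.ext h rfl

theorem hom_ext_cons {f g : TensorAlgebra K A →ₗ[K] M} (h1 : f 1 = g 1)
    (h : ∀ a x, f (TensorAlgebra.ι K a * x) = g (TensorAlgebra.ι K a * x)) : f = g := by
  have key : ∀ x p : TensorAlgebra K A, f p = g p → f (x * p) = g (x * p) := by
    intro x
    induction x using TensorAlgebra.induction with
    | algebraMap r => intro p hp; simp [← Algebra.smul_def, hp]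
    | ι b => intro p _; exact h b p
    | mul x y hx hy => intro p hp; rw [mul_assoc]; exact hx _ (hy _ hp)
    | add x y hx hy => intro p hp; rw [add_mul, map_add, map_add, hx p hp, hy p hp]
  ext x
  simpa using key x 1 h1

variable (K A) in
/-- Splitting off the first letter, `T(A) → A ⊗ T(A)`: scalars go to `0` and the tensor
`a ⊗ x` of `T(A)` goes to `a ⊗ x`. -/
def uncons : TensorAlgebra K A →ₗ[K] A ⊗[K] TensorAlgebra K A :=
  leftRec 0
    ((LinearMap.lcomp K _ (LinearMap.fst K _ _)) ∘ₗ TensorProduct.mk K A (TensorAlgebra K A))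

theorem uncons_one : uncons K A 1 = 0 := leftRec_one _ _

theorem uncons_ι_mul (a : A) (x : TensorAlgebra K A) :
    uncons K A (TensorAlgebra.ι K a * x) = a ⊗ₜ x := by
  simp [uncons, leftRec_ι_mul]

variable (K A) in
/-- `(id_A ⊗ f)`, followed by `A ⊗ T(A) ⊆ T(A)`, linearly in `f`: it sends `f` and
`a ⊗ x` to the tensor `a ⊗ f x` of `T(A)`. -/
def consMap : (TensorAlgebra K A →ₗ[K] TensorAlgebra K A) →ₗ[K]
    A ⊗[K] TensorAlgebra K A →ₗ[K] TensorAlgebra K A :=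
  (LinearMap.llcomp K _ _ _
    (TensorProduct.lift ((LinearMap.mul K (TensorAlgebra K A)) ∘ₗ TensorAlgebra.ι K))) ∘ₗ
    (LinearMap.lTensorHom A)

theorem consMap_tmul (f : TensorAlgebra K A →ₗ[K] TensorAlgebra K A) (a : A)
    (x : TensorAlgebra K A) :
    consMap K A f (a ⊗ₜ x) = TensorAlgebra.ι K a * f x := by
  simp [consMap]

end FirstLetter

section Products

variable {K A : Type*} [CommRing K]

/-- The maps `β_{i,1} : A^{⊗ i} ⊗ A → A ⊗ A^{⊗ i}`, for all `i` together, as a bilinear map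
on `T(A) × A`. The permutation `χ_{i,1}` has `s₁ s₂ ⋯ s_i` as its reduced expression, so
`β_{i,1} = σ₁ σ₂ ⋯ σ_i`; that is, `β_{0,1}` is the identity and
`β_{i+1,1} = (σ ⊗ id) (id_A ⊗ β_{i,1})`; the map `(consMap K A id).lTensor A` only identifies
`A ⊗ (A ⊗ A^{⊗ i})` with `A ⊗ A^{⊗ (i+1)}`. -/
def braidLetter [AddCommGroup A] [Module K A] (σ : A ⊗[K] A →ₗ[K] A ⊗[K] A) :
    TensorAlgebra K A →ₗ[K] A →ₗ[K] A ⊗[K] TensorAlgebra K A :=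
  leftRec ((TensorProduct.mk K A (TensorAlgebra K A)).flip 1)
    (LinearMap.mk₂ K
      (fun a p =>
        (consMap K A LinearMap.id).lTensor A ∘ₗ onFirstTwo σ (TensorAlgebra K A) ∘ₗ
          TensorProduct.mk K A _ a ∘ₗ p.2)
      (by intros; ext; simp [TensorProduct.add_tmul])
      (by intros; ext; simp [← TensorProduct.smul_tmul'])
      (by intros; ext; simp [TensorProduct.tmul_add])
      (by intros; ext; simp))

theorem braidLetter_one [AddCommGroup A] [Module K A] (σ : A ⊗[K] A →ₗ[K] A ⊗[K] A)
    (b : A) : braidLetter σ 1 b = b ⊗ₜ 1 := by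
  simp [braidLetter, leftRec_one]

theorem braidLetter_ι_mul [AddCommGroup A] [Module K A] (σ : A ⊗[K] A →ₗ[K] A ⊗[K] A)
    (a b : A) (x : TensorAlgebra K A) :
    braidLetter σ (TensorAlgebra.ι K a * x) b =
      (consMap K A LinearMap.id).lTensor A
        (onFirstTwo σ (TensorAlgebra K A) (a ⊗ₜ braidLetter σ x b)) := by
  simp [braidLetter, leftRec_ι_mul]

variable [NonUnitalRing A] [Module K A] [IsScalarTower K A A] [SMulCommClass K A A]

/-- `a, x, b ↦ (m ⊗ id) (id_A ⊗ β_{i,1}) (a ⊗ x ⊗ b)`, an element of `A ⊗ T(A)`. -/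
def mergeLetter (σ : A ⊗[K] A →ₗ[K] A ⊗[K] A) :
    A →ₗ[K] TensorAlgebra K A →ₗ[K] A →ₗ[K] A ⊗[K] TensorAlgebra K A :=
  LinearMap.mk₂ K
    (fun a x => (LinearMap.mul K A a).rTensor (TensorAlgebra K A) ∘ₗ braidLetter σ x)
    (by intros; ext; simp [LinearMap.rTensor_add])
    (by intros; ext; simp [LinearMap.rTensor_smul])
    (by intros; ext; simp)
    (by intros; ext; simp)

theorem mergeLetter_apply (σ : A ⊗[K] A →ₗ[K] A ⊗[K] A) (a b : A) (x : TensorAlgebra K A) :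
    mergeLetter σ a x b =
      (LinearMap.mul K A a).rTensor (TensorAlgebra K A) (braidLetter σ x b) := rfl

/-- The product of `x` with a tensor `b ⊗ y`, computed by recursion on `x` from `b`, `y` and
the linear map `R = (· ⋈ y)`. -/
def joinCons (σ : A ⊗[K] A →ₗ[K] A ⊗[K] A) : TensorAlgebra K A →ₗ[K]
    (A ⊗[K] (TensorAlgebra K A × (TensorAlgebra K A →ₗ[K] TensorAlgebra K A))) →ₗ[K]
      TensorAlgebra K A :=
  leftRec
    (TensorProduct.lift
      (LinearMap.mk₂ K (fun b p => TensorAlgebra.ι K b * p.1)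
        (by intros; simp [add_mul]) (by intros; simp)
        (by intros; simp [mul_add]) (by intros; simp)))
    (LinearMap.mk₂ K
      (fun a q =>
        LinearMap.mulLeft K (TensorAlgebra.ι K a) ∘ₗ q.2 +
        TensorProduct.lift
          (LinearMap.mk₂ K
            (fun b p =>
              consMap K A p.2 (braidLetter σ (TensorAlgebra.ι K a * q.1) b) +
              consMap K A p.2 (mergeLetter σ a q.1 b))
            (by intros; simp only [map_add]; abel)
            (by intros; simp)
            (by intros; simp only [Prod.snd_add, map_add, LinearMap.add_apply]; abel)
            (by intros; simp)))
      (by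
        intros
        ext <;> simp [add_mul]
        abel)
      (by
        intros
        ext <;> simp)
      (by
        intros
        ext <;> simp [mul_add]
        abel)
      (by
        intros
        ext <;> simp))

/-- Auxiliary form of the quantum quasi-shuffle product, by recursion on the right factor:
`joinRight σ y` is the map `x ↦ x ⋈ y`. -/
def joinRight (σ : A ⊗[K] A →ₗ[K] A ⊗[K] A) :
    TensorAlgebra K A →ₗ[K] TensorAlgebra K A →ₗ[K] TensorAlgebra K A :=
  leftRec LinearMap.id
    (LinearMap.mk₂ K
      (fun b p => (joinCons σ).flip (b ⊗ₜ p))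
      (by intros; simp only [TensorProduct.add_tmul, map_add])
      (by intros; simp only [← TensorProduct.smul_tmul', map_smul])
      (by intros; simp only [TensorProduct.tmul_add, map_add])
      (by intros; simp only [TensorProduct.tmul_smul, map_smul]))

/-- The quantum quasi-shuffle product `⋈_σ` on `T(A)`. It is the bilinear map with
`1 ⋈ x = x ⋈ 1 = x` and, for `x ∈ A^{⊗ i}` and `y ∈ A^{⊗ j}`,
`(a ⊗ x) ⋈ (b ⊗ y) = a ⊗ (x ⋈ (b ⊗ y)) + (id ⊗ ⋈) (β_{i+1,1} ⊗ id) (a ⊗ x ⊗ b ⊗ y)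
  + (m ⊗ ⋈) (id ⊗ β_{i,1} ⊗ id) (a ⊗ x ⊗ b ⊗ y)`. -/
def join (σ : A ⊗[K] A →ₗ[K] A ⊗[K] A) :
    TensorAlgebra K A →ₗ[K] TensorAlgebra K A →ₗ[K] TensorAlgebra K A :=
  (joinRight σ).flip

theorem join_one (σ : A ⊗[K] A →ₗ[K] A ⊗[K] A) (x : TensorAlgebra K A) :
    join σ x 1 = x := by
  simp [join, joinRight, leftRec_one]

theorem join_cons (σ : A ⊗[K] A →ₗ[K] A ⊗[K] A) (b : A) (x y : TensorAlgebra K A) :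
    join σ x (TensorAlgebra.ι K b * y) = joinCons σ x (b ⊗ₜ (y, (join σ).flip y)) := by
  simp [join, joinRight, leftRec_ι_mul, LinearMap.flip_flip]

theorem one_join (σ : A ⊗[K] A →ₗ[K] A ⊗[K] A) (x : TensorAlgebra K A) :
    join σ 1 x = x := by
  have h : join σ 1 = LinearMap.id :=
    hom_ext_cons (by simp [join_one]) (by intros; simp [join_cons, joinCons, leftRec_one])
  simp [h]

theorem cons_join_cons (σ : A ⊗[K] A →ₗ[K] A ⊗[K] A) (a b : A) (x y : TensorAlgebra K A) :
    join σ (TensorAlgebra.ι K a * x) (TensorAlgebra.ι K b * y) =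
      TensorAlgebra.ι K a * join σ x (TensorAlgebra.ι K b * y) +
      consMap K A ((join σ).flip y) (braidLetter σ (TensorAlgebra.ι K a * x) b) +
      consMap K A ((join σ).flip y) (mergeLetter σ a x b) := by
  rw [join_cons, join_cons, joinCons, leftRec_ι_mul]
  simp [add_assoc]

/-- The operation `≺` on `T(A)`: `(a ⊗ x) ≺ z = a ⊗ (x ⋈ z)` and `1 ≺ z = 0`. -/
def prec (σ : A ⊗[K] A →ₗ[K] A ⊗[K] A) :
    TensorAlgebra K A →ₗ[K] TensorAlgebra K A →ₗ[K] TensorAlgebra K A :=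
  LinearMap.mk₂ K (fun x z => consMap K A ((join σ).flip z) (uncons K A x))
    (by intros; simp) (by intros; simp) (by intros; simp) (by intros; simp)

/-- `b ⊗ y ↦ (z ↦ (id ⊗ ⋈) (β_{k,1} ⊗ id) (z ⊗ b ⊗ y))`, for `z ∈ A^{⊗ k}`. -/
def succAux (σ : A ⊗[K] A →ₗ[K] A ⊗[K] A) (z : TensorAlgebra K A) :
    A ⊗[K] TensorAlgebra K A →ₗ[K] TensorAlgebra K A :=
  TensorProduct.lift
    (LinearMap.mk₂ K (fun b y => consMap K A ((join σ).flip y) (braidLetter σ z b))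
      (by intros; simp) (by intros; simp) (by intros; simp) (by intros; simp))

/-- The operation `≻` on `T(A)`: for `z ∈ A^{⊗ k}`,
`z ≻ (b ⊗ y) = (id ⊗ ⋈) (β_{k,1} ⊗ id) (z ⊗ b ⊗ y)`, and `z ≻ 1 = 0`. -/
def succ (σ : A ⊗[K] A →ₗ[K] A ⊗[K] A) :
    TensorAlgebra K A →ₗ[K] TensorAlgebra K A →ₗ[K] TensorAlgebra K A :=
  LinearMap.mk₂ K (fun z w => succAux σ z (uncons K A w))
    (by
      intro z z' w
      have h : succAux σ (z + z') = succAux σ z + succAux σ z' := by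
        ext; simp [succAux]
      rw [h, LinearMap.add_apply])
    (by
      intro c z w
      have h : succAux σ (c • z) = c • succAux σ z := by
        ext; simp [succAux]
      rw [h, LinearMap.smul_apply])
    (by intros; simp) (by intros; simp)

/-- `(a ⊗ x) ⊗ (b ⊗ y) ↦ (m ⊗ ⋈) (id ⊗ β_{i,1} ⊗ id) (a ⊗ x ⊗ b ⊗ y)`, for
`x ∈ A^{⊗ i}`. -/
def dotAux (σ : A ⊗[K] A →ₗ[K] A ⊗[K] A) :
    (A ⊗[K] TensorAlgebra K A) →ₗ[K] (A ⊗[K] TensorAlgebra K A) →ₗ[K] TensorAlgebra K A :=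
  TensorProduct.lift
    (LinearMap.mk₂ K
      (fun a x =>
        TensorProduct.lift
          (LinearMap.mk₂ K (fun b y => consMap K A ((join σ).flip y) (mergeLetter σ a x b))
            (by intros; simp) (by intros; simp) (by intros; simp) (by intros; simp)))
      (by intros; ext; simp) (by intros; ext; simp)
      (by intros; ext; simp) (by intros; ext; simp))

/-- The operation `·` on `T(A)`: for `x ∈ A^{⊗ i}`,
`(a ⊗ x) · (b ⊗ y) = (m ⊗ ⋈) (id ⊗ β_{i,1} ⊗ id) (a ⊗ x ⊗ b ⊗ y)`, while
`1 · 1 = 1` and `1 · (b ⊗ y) = (a ⊗ x) · 1 = 0`. -/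
def dot (σ : A ⊗[K] A →ₗ[K] A ⊗[K] A) :
    TensorAlgebra K A →ₗ[K] TensorAlgebra K A →ₗ[K] TensorAlgebra K A :=
  (dotAux σ).compl₁₂ (uncons K A) (uncons K A) +
    LinearMap.mk₂ K
      (fun z w => algebraMap K (TensorAlgebra K A)
        (TensorAlgebra.algebraMapInv z * TensorAlgebra.algebraMapInv w))
      (by intros; simp [add_mul]) (by intros; simp [Algebra.smul_def, mul_assoc])
      (by intros; simp [mul_add]) (by intros; simp [Algebra.smul_def, mul_left_comm])

theorem cons_prec (σ : A ⊗[K] A →ₗ[K] A ⊗[K] A) (a : A) (x z : TensorAlgebra K A) :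
    prec σ (TensorAlgebra.ι K a * x) z = TensorAlgebra.ι K a * join σ x z := by
  simp [prec, uncons_ι_mul, consMap_tmul]

theorem one_prec (σ : A ⊗[K] A →ₗ[K] A ⊗[K] A) (z : TensorAlgebra K A) :
    prec σ 1 z = 0 := by
  simp [prec, uncons_one]

theorem succ_cons (σ : A ⊗[K] A →ₗ[K] A ⊗[K] A) (b : A) (z y : TensorAlgebra K A) :
    succ σ z (TensorAlgebra.ι K b * y) =
      consMap K A ((join σ).flip y) (braidLetter σ z b) := by
  simp [succ, succAux, uncons_ι_mul]

theorem succ_one (σ : A ⊗[K] A →ₗ[K] A ⊗[K] A) (z : TensorAlgebra K A) :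
    succ σ z 1 = 0 := by
  simp [succ, uncons_one]

theorem cons_dot_cons (σ : A ⊗[K] A →ₗ[K] A ⊗[K] A) (a b : A) (x y : TensorAlgebra K A) :
    dot σ (TensorAlgebra.ι K a * x) (TensorAlgebra.ι K b * y) =
      consMap K A ((join σ).flip y) (mergeLetter σ a x b) := by
  simp [dot, dotAux, uncons_ι_mul, TensorAlgebra.algebraMapInv]

theorem one_dot_one (σ : A ⊗[K] A →ₗ[K] A ⊗[K] A) : dot σ 1 1 = 1 := by
  simp [dot, uncons_one]

theorem one_dot_cons (σ : A ⊗[K] A →ₗ[K] A ⊗[K] A) (b : A) (y : TensorAlgebra K A) :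
    dot σ 1 (TensorAlgebra.ι K b * y) = 0 := by
  simp [dot, uncons_one, TensorAlgebra.algebraMapInv]

theorem cons_dot_one (σ : A ⊗[K] A →ₗ[K] A ⊗[K] A) (a : A) (x : TensorAlgebra K A) :
    dot σ (TensorAlgebra.ι K a * x) 1 = 0 := by
  simp [dot, uncons_one, TensorAlgebra.algebraMapInv]

/-- The three operations split `⋈_σ`. -/
theorem prec_add_succ_add_dot (σ : A ⊗[K] A →ₗ[K] A ⊗[K] A) (x y : TensorAlgebra K A) :
    prec σ x y + succ σ x y + dot σ x y = join σ x y := by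
  have h : prec σ + succ σ + dot σ = join σ := by
    refine hom_ext_cons (hom_ext_cons ?_ fun b y => ?_)
      fun a x => hom_ext_cons ?_ fun b y => ?_
    · simp [one_prec, succ_one, one_dot_one, one_join]
    · simp [one_prec, succ_cons, one_dot_cons, one_join, braidLetter_one, consMap_tmul]
    · simp [cons_prec, succ_one, cons_dot_one, join_one]
    · simp [cons_prec, succ_cons, cons_dot_cons, cons_join_cons]
  rw [← h]; rfl

end Products

end QuantumQuasiShuffle

end

/-!
The operations are best understood through the map `B = braidThen σ (join σ)`, that is
`B x (b ⊗ y) = (id ⊗ ⋈) (β ⊗ id) (x ⊗ b ⊗ y)`, from `T(A) ⊗ (A ⊗ T(A))` to `A ⊗ T(A)`.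
Up to the constant terms, `T(A)` is identified with `A ⊗ T(A)` by splitting off the first
letter, and the operations become, for `u, t` in `A ⊗ T(A)`,
* `u ≺ z = (id ⊗ (· ⋈ z)) u`,
* `x ≻ t = B x t`,
* `u · t = (m ⊗ id) (id ⊗ (B · t)) u`, with the extra term `1 · 1 = 1`
(`prec_eq`, `succ_eq`, `dot_eq`). In this form the seven relations follow formally from three
facts: `⋈` is associative; `B` is an action of `(T(A), ⋈)` on `A ⊗ T(A)` which commutes with
right multiplication by `⋈` on `T(A)`; and moving a word past two letters commutes with
multiplying these letters (`IsBraidedAlgebra.mulFirst_braidThen`, from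
`(m ⊗ id) σ₂ σ₁ = σ (id ⊗ m)`).

The action property reduces, given associativity, to the compatibility of the braiding with
`⋈` in `IsBraidedAlgebra.braidLetter_join`, where the Yang-Baxter equation takes care of the
summand `≻` and `(id ⊗ m) σ₁ σ₂ = σ (m ⊗ id)` of the summand `·`.

Associativity `(X ⋈ Y) ⋈ Z = X ⋈ (Y ⋈ Z)` is the sum of the seven relations. For
`X = a ⊗ x`, `Y = b ⊗ y`, `Z = c ⊗ z`, each relation only needs associativity for triples
`(x, Y, Z)`, `(x', y, Z)` or `(x', y', z)` with `x'`, `y'` arbitrary. Hence the relations are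
first derived under such hypotheses, and associativity follows by an induction on `Z`, inside
it on `Y` and inside that on `X` (`IsBraidedAlgebra.join_assoc`).
-/

namespace QuantumQuasiShuffle

/-! ### Naturality of the braiding and its identities with an extra tensor factor -/

section Naturality

variable {K A : Type*} [CommRing K] [AddCommGroup A] [Module K A]
  {W W' : Type*} [AddCommGroup W] [Module K W] [AddCommGroup W'] [Module K W']

theorem onFirstTwo_lTensor_lTensor (σ : A ⊗[K] A →ₗ[K] A ⊗[K] A) (f : W →ₗ[K] W')
    (t : A ⊗[K] (A ⊗[K] W)) :
    onFirstTwo σ W' ((f.lTensor A).lTensor A t) =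
      (f.lTensor A).lTensor A (onFirstTwo σ W t) := by
  have assoc_nat : ∀ s : (A ⊗[K] A) ⊗[K] W,
      TensorProduct.assoc K A A W' (f.lTensor (A ⊗[K] A) s) =
        (f.lTensor A).lTensor A (TensorProduct.assoc K A A W s) := by
    intro s
    refine LinearMap.congr_fun (f := (TensorProduct.assoc K A A W').toLinearMap ∘ₗ
      f.lTensor (A ⊗[K] A)) (g := (f.lTensor A).lTensor A ∘ₗ
        (TensorProduct.assoc K A A W).toLinearMap) ?_ s
    ext; simp
  obtain ⟨s, rfl⟩ := (TensorProduct.assoc K A A W).surjective t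
  simp only [onFirstTwo, LinearMap.comp_apply, LinearEquiv.coe_coe, ← assoc_nat,
    LinearEquiv.symm_apply_apply]
  congr 1
  simp only [← LinearMap.comp_apply, LinearMap.rTensor_comp_lTensor,
    LinearMap.lTensor_comp_rTensor]

/-- Appending a fixed factor `w` carries `σ` on `A ⊗ A` to `σ₁` on `A ⊗ (A ⊗ W)`. -/
theorem onFirstTwo_lTensor_mk (σ : A ⊗[K] A →ₗ[K] A ⊗[K] A) (w : W) (t : A ⊗[K] A) :
    onFirstTwo σ W (((TensorProduct.mk K A W).flip w).lTensor A t) =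
      ((TensorProduct.mk K A W).flip w).lTensor A (σ t) := by
  have h : ∀ s : A ⊗[K] A, ((TensorProduct.mk K A W).flip w).lTensor A s =
      TensorProduct.assoc K A A W (s ⊗ₜ w) := by
    intro s
    induction s with
    | zero => simp
    | tmul a b => simp
    | add s s' hs hs' => simp only [map_add, TensorProduct.add_tmul, hs, hs']
  rw [h, h]
  simp [onFirstTwo]

/-- Two maps out of `A ⊗ (A ⊗ (A ⊗ W))` agree as soon as they agree on the images of
`A ⊗ (A ⊗ A)` obtained by appending a fixed `w : W`. -/
theorem ext_append_last {f g : A ⊗[K] (A ⊗[K] (A ⊗[K] W)) →ₗ[K] W'}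
    (h : ∀ w, ∀ t : A ⊗[K] (A ⊗[K] A),
      f ((((TensorProduct.mk K A W).flip w).lTensor A).lTensor A t) =
        g ((((TensorProduct.mk K A W).flip w).lTensor A).lTensor A t)) : f = g := by
  ext a b c w
  simpa using h w (a ⊗ₜ (b ⊗ₜ c))

theorem lTensor_onFirstTwo_append (σ : A ⊗[K] A →ₗ[K] A ⊗[K] A) (w : W)
    (t : A ⊗[K] (A ⊗[K] A)) :
    (onFirstTwo σ W).lTensor A ((((TensorProduct.mk K A W).flip w).lTensor A).lTensor A t) =
      (((TensorProduct.mk K A W).flip w).lTensor A).lTensor A (σ.lTensor A t) := by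
  simp only [← LinearMap.comp_apply, ← LinearMap.lTensor_comp]
  congr 2
  exact LinearMap.ext (onFirstTwo_lTensor_mk σ w)

/-- The Yang-Baxter equation on `A ⊗ A ⊗ A ⊗ W`. -/
theorem IsBraiding.yang_baxter_tensor {σ : A ⊗[K] A →ₗ[K] A ⊗[K] A} (hσ : IsBraiding σ)
    (t : A ⊗[K] (A ⊗[K] (A ⊗[K] W))) :
    onFirstTwo σ (A ⊗[K] W) ((onFirstTwo σ W).lTensor A (onFirstTwo σ (A ⊗[K] W) t)) =
      (onFirstTwo σ W).lTensor A
        (onFirstTwo σ (A ⊗[K] W) ((onFirstTwo σ W).lTensor A t)) := by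
  refine LinearMap.congr_fun (f := onFirstTwo σ (A ⊗[K] W) ∘ₗ (onFirstTwo σ W).lTensor A ∘ₗ
    onFirstTwo σ (A ⊗[K] W)) (g := (onFirstTwo σ W).lTensor A ∘ₗ onFirstTwo σ (A ⊗[K] W) ∘ₗ
      (onFirstTwo σ W).lTensor A) (ext_append_last fun w s => ?_) t
  simp only [LinearMap.comp_apply, onFirstTwo_lTensor_lTensor, lTensor_onFirstTwo_append]
  exact congrArg _ (LinearMap.congr_fun hσ.yang_baxter s)

end Naturality

/-! ### Multiplying the first two factors -/

section MulFirst

variable {K A : Type*} [CommRing K] [NonUnitalRing A] [Module K A] [IsScalarTower K A A]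
  [SMulCommClass K A A]
  {W W' : Type*} [AddCommGroup W] [Module K W] [AddCommGroup W'] [Module K W']

variable (K A W) in
/-- The product of `A` on the first two factors, `m ⊗ id : A ⊗ (A ⊗ W) → A ⊗ W`. -/
noncomputable def mulFirst : A ⊗[K] (A ⊗[K] W) →ₗ[K] A ⊗[K] W :=
  (LinearMap.mul' K A).rTensor W ∘ₗ (TensorProduct.assoc K A A W).symm.toLinearMap

theorem mulFirst_tmul_tmul (a b : A) (w : W) :
    mulFirst K A W (a ⊗ₜ (b ⊗ₜ w)) = (a * b) ⊗ₜ w := by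
  simp [mulFirst]

theorem mulFirst_tmul (a : A) (t : A ⊗[K] W) :
    mulFirst K A W (a ⊗ₜ t) = (LinearMap.mul K A a).rTensor W t := by
  induction t with
  | zero => simp
  | tmul b w => simp [mulFirst_tmul_tmul]
  | add s t hs ht => simp only [map_add, TensorProduct.tmul_add, hs, ht]

theorem mulFirst_lTensor_lTensor (f : W →ₗ[K] W') (t : A ⊗[K] (A ⊗[K] W)) :
    mulFirst K A W' ((f.lTensor A).lTensor A t) = f.lTensor A (mulFirst K A W t) := by
  refine LinearMap.congr_fun (f := mulFirst K A W' ∘ₗ (f.lTensor A).lTensor A)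
    (g := f.lTensor A ∘ₗ mulFirst K A W) ?_ t
  ext; simp [mulFirst_tmul_tmul]

theorem mulFirst_mulFirst (t : A ⊗[K] (A ⊗[K] (A ⊗[K] W))) :
    mulFirst K A W (mulFirst K A (A ⊗[K] W) t) =
      mulFirst K A W ((mulFirst K A W).lTensor A t) := by
  refine LinearMap.congr_fun (f := mulFirst K A W ∘ₗ mulFirst K A (A ⊗[K] W))
    (g := mulFirst K A W ∘ₗ (mulFirst K A W).lTensor A) ?_ t
  ext; simp [mulFirst_tmul_tmul, mul_assoc]

theorem lTensor_mulFirst_append (w : W) (t : A ⊗[K] (A ⊗[K] A)) :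
    (mulFirst K A W).lTensor A ((((TensorProduct.mk K A W).flip w).lTensor A).lTensor A t) =
      ((TensorProduct.mk K A W).flip w).lTensor A ((LinearMap.mul' K A).lTensor A t) := by
  simp only [← LinearMap.comp_apply, ← LinearMap.lTensor_comp]
  congr 2
  ext; simp [mulFirst_tmul_tmul]

/-- `(id ⊗ m) σ₁ σ₂ = σ₁ (m ⊗ id)` on `A ⊗ A ⊗ A ⊗ W`. -/
theorem IsBraidedAlgebra.mul_left_tensor {σ : A ⊗[K] A →ₗ[K] A ⊗[K] A}
    (hσ : IsBraidedAlgebra σ) (t : A ⊗[K] (A ⊗[K] (A ⊗[K] W))) :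
    (mulFirst K A W).lTensor A
        (onFirstTwo σ (A ⊗[K] W) ((onFirstTwo σ W).lTensor A t)) =
      onFirstTwo σ W (mulFirst K A (A ⊗[K] W) t) := by
  refine LinearMap.congr_fun (f := (mulFirst K A W).lTensor A ∘ₗ onFirstTwo σ (A ⊗[K] W) ∘ₗ
    (onFirstTwo σ W).lTensor A) (g := onFirstTwo σ W ∘ₗ mulFirst K A (A ⊗[K] W))
    (ext_append_last fun w s => ?_) t
  simp only [LinearMap.comp_apply, onFirstTwo_lTensor_lTensor, lTensor_onFirstTwo_append,
    lTensor_mulFirst_append, mulFirst_lTensor_lTensor, onFirstTwo_lTensor_mk]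
  exact congrArg _ (LinearMap.congr_fun hσ.mul_left s)

/-- `(m ⊗ id) σ₂ σ₁ = σ₁ (id ⊗ m)` on `A ⊗ A ⊗ A ⊗ W`. -/
theorem IsBraidedAlgebra.mul_right_tensor {σ : A ⊗[K] A →ₗ[K] A ⊗[K] A}
    (hσ : IsBraidedAlgebra σ) (t : A ⊗[K] (A ⊗[K] (A ⊗[K] W))) :
    mulFirst K A (A ⊗[K] W)
        ((onFirstTwo σ W).lTensor A (onFirstTwo σ (A ⊗[K] W) t)) =
      onFirstTwo σ W ((mulFirst K A W).lTensor A t) := by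
  refine LinearMap.congr_fun (f := mulFirst K A (A ⊗[K] W) ∘ₗ (onFirstTwo σ W).lTensor A ∘ₗ
    onFirstTwo σ (A ⊗[K] W)) (g := onFirstTwo σ W ∘ₗ (mulFirst K A W).lTensor A)
    (ext_append_last fun w s => ?_) t
  simp only [LinearMap.comp_apply, onFirstTwo_lTensor_lTensor, lTensor_onFirstTwo_append,
    lTensor_mulFirst_append, mulFirst_lTensor_lTensor, onFirstTwo_lTensor_mk]
  exact congrArg _ (LinearMap.congr_fun hσ.mul_right s)

end MulFirst

/-! ### Moving a word past letters -/

section BraidThen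

variable {K A : Type*} [CommRing K] [AddCommGroup A] [Module K A]
  {W W' V V' : Type*} [AddCommGroup W] [Module K W] [AddCommGroup W'] [Module K W']
  [AddCommGroup V] [Module K V] [AddCommGroup V'] [Module K V']

variable (K A) in
/-- Prepending a letter, `A ⊗ T(A) ⊆ T(A)`. -/
noncomputable abbrev cons : A ⊗[K] TensorAlgebra K A →ₗ[K] TensorAlgebra K A :=
  consMap K A LinearMap.id

theorem cons_tmul (a : A) (x : TensorAlgebra K A) :
    cons K A (a ⊗ₜ x) = TensorAlgebra.ι K a * x := by
  simp [consMap_tmul]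

theorem consMap_eq_cons_lTensor (f : TensorAlgebra K A →ₗ[K] TensorAlgebra K A)
    (t : A ⊗[K] TensorAlgebra K A) : consMap K A f t = cons K A (f.lTensor A t) := by
  induction t with
  | zero => simp
  | tmul a x => simp [consMap_tmul]
  | add s t hs ht => simp only [map_add, hs, ht]

theorem uncons_cons (t : A ⊗[K] TensorAlgebra K A) : uncons K A (cons K A t) = t := by
  induction t with
  | zero => simp
  | tmul a x => rw [cons_tmul, uncons_ι_mul]
  | add s t hs ht => simp only [map_add, hs, ht]

theorem algebraMapInv_cons (t : A ⊗[K] TensorAlgebra K A) :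
    TensorAlgebra.algebraMapInv (cons K A t) = 0 := by
  induction t with
  | zero => simp
  | tmul a x => simp [cons_tmul, TensorAlgebra.algebraMapInv]
  | add s t hs ht => simp only [map_add, hs, ht, add_zero]

/-- Induction on the first letter. -/
theorem cons_induction {p : TensorAlgebra K A → Prop} (one : p 1)
    (cons : ∀ a x, p x → p (TensorAlgebra.ι K a * x))
    (add : ∀ x y, p x → p y → p (x + y)) (smul : ∀ (r : K) x, p x → p (r • x))
    (x : TensorAlgebra K A) : p x := by
  have key : ∀ x y : TensorAlgebra K A, p y → p (x * y) := by
    intro x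
    induction x using TensorAlgebra.induction with
    | algebraMap r => intro y hy; rw [← Algebra.smul_def]; exact smul r y hy
    | ι a => exact cons a
    | mul x x' hx hx' => intro y hy; rw [mul_assoc]; exact hx _ (hx' _ hy)
    | add x x' hx hx' => intro y hy; rw [add_mul]; exact add _ _ (hx _ hy) (hx' _ hy)
  simpa using key x 1 one

/-- For a bilinear map `H : T(A) × W → V`, the composite `(id_A ⊗ H) (β ⊗ id_W)` on
`T(A) ⊗ A ⊗ W`: a word is moved past a letter and then combined with `W` through `H`. -/
noncomputable def braidThen (σ : A ⊗[K] A →ₗ[K] A ⊗[K] A)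
    (H : TensorAlgebra K A →ₗ[K] W →ₗ[K] V) :
    TensorAlgebra K A →ₗ[K] A ⊗[K] W →ₗ[K] A ⊗[K] V :=
  (TensorProduct.lift (LinearMap.mk₂ K
    (fun b w => (H.flip w).lTensor A ∘ₗ (braidLetter σ).flip b)
    (by intros; ext; simp) (by intros; ext; simp)
    (by intros; ext; simp [LinearMap.lTensor_add])
    (by intros; ext; simp [LinearMap.lTensor_smul]))).flip

theorem braidThen_tmul (σ : A ⊗[K] A →ₗ[K] A ⊗[K] A)
    (H : TensorAlgebra K A →ₗ[K] W →ₗ[K] V) (x : TensorAlgebra K A) (b : A) (w : W) :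
    braidThen σ H x (b ⊗ₜ w) = (H.flip w).lTensor A (braidLetter σ x b) := by
  simp [braidThen]

theorem braidThen_add (σ : A ⊗[K] A →ₗ[K] A ⊗[K] A)
    (H H' : TensorAlgebra K A →ₗ[K] W →ₗ[K] V) (x : TensorAlgebra K A) (t : A ⊗[K] W) :
    braidThen σ (H + H') x t = braidThen σ H x t + braidThen σ H' x t := by
  induction t with
  | zero => simp
  | tmul b w =>
    have h : (H + H').flip w = H.flip w + H'.flip w := by ext; simp
    simp [braidThen_tmul, h, LinearMap.lTensor_add]
  | add s t hs ht => simp only [map_add, hs, ht]; abel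

theorem braidThen_one (σ : A ⊗[K] A →ₗ[K] A ⊗[K] A)
    (H : TensorAlgebra K A →ₗ[K] W →ₗ[K] V) (t : A ⊗[K] W) :
    braidThen σ H 1 t = (H 1).lTensor A t := by
  induction t with
  | zero => simp
  | tmul b w => simp [braidThen_tmul, braidLetter_one]
  | add s t hs ht => simp only [map_add, hs, ht]

/-- Naturality of `braidThen` in the bilinear map. -/
theorem braidThen_lTensor (σ : A ⊗[K] A →ₗ[K] A ⊗[K] A)
    {H : TensorAlgebra K A →ₗ[K] W →ₗ[K] V} {H' : TensorAlgebra K A →ₗ[K] W' →ₗ[K] V'}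
    {f : W →ₗ[K] W'} {g : V →ₗ[K] V'} (h : ∀ x w, H' x (f w) = g (H x w))
    (x : TensorAlgebra K A) (t : A ⊗[K] W) :
    braidThen σ H' x (f.lTensor A t) = g.lTensor A (braidThen σ H x t) := by
  induction t with
  | zero => simp
  | tmul b w =>
    have h' : H'.flip (f w) = g ∘ₗ H.flip w := by ext y; exact h y w
    simp [braidThen_tmul, h', LinearMap.lTensor_comp]
  | add s t hs ht => simp only [map_add, hs, ht]

/-- `β (ax ⊗ b ⊗ c) = σ₂ σ₁ (a ⊗ β (x ⊗ b ⊗ c))` for a word moving past two letters. -/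
theorem braidThen_braidLetter_ι_mul (σ : A ⊗[K] A →ₗ[K] A ⊗[K] A) (a : A)
    (x : TensorAlgebra K A) (t : A ⊗[K] A) :
    braidThen σ (braidLetter σ) (TensorAlgebra.ι K a * x) t =
      ((cons K A).lTensor A).lTensor A ((onFirstTwo σ (TensorAlgebra K A)).lTensor A
        (onFirstTwo σ (A ⊗[K] TensorAlgebra K A)
          (a ⊗ₜ braidThen σ (braidLetter σ) x t))) := by
  induction t with
  | zero => simp
  | tmul b c =>
    have h : (braidLetter σ).flip c ∘ₗ cons K A = (cons K A).lTensor A ∘ₗ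
        onFirstTwo σ (TensorAlgebra K A) ∘ₗ ((braidLetter σ).flip c).lTensor A := by
      ext a x
      simp [cons_tmul, braidLetter_ι_mul]
    have e : (a ⊗ₜ[K] ((braidLetter σ).flip c).lTensor A (braidLetter σ x b)) =
        (((braidLetter σ).flip c).lTensor A).lTensor A (a ⊗ₜ[K] braidLetter σ x b) := by
      simp
    rw [braidThen_tmul, braidThen_tmul, braidLetter_ι_mul, e, onFirstTwo_lTensor_lTensor]
    simpa only [LinearMap.lTensor_comp, LinearMap.comp_apply] using
      LinearMap.congr_fun (congrArg (LinearMap.lTensor A) h) _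
  | add s t hs ht => simp only [map_add, TensorProduct.tmul_add, hs, ht]

/-- The two letters that a word is moved past may be braided before or after: the Yang-Baxter
equation for `T(A) ⊗ A ⊗ A`, in which `braidThen σ (braidLetter σ)` is `(id ⊗ β) (β ⊗ id)`. -/
theorem IsBraiding.onFirstTwo_braidThen_braidLetter {σ : A ⊗[K] A →ₗ[K] A ⊗[K] A}
    (hσ : IsBraiding σ) (x : TensorAlgebra K A) (t : A ⊗[K] A) :
    onFirstTwo σ (TensorAlgebra K A) (braidThen σ (braidLetter σ) x t) =
      braidThen σ (braidLetter σ) x (σ t) := by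
  induction x using cons_induction with
  | one =>
    have h : braidLetter σ 1 = (TensorProduct.mk K A (TensorAlgebra K A)).flip 1 := by
      ext b; simp [braidLetter_one]
    rw [braidThen_one, braidThen_one, h, onFirstTwo_lTensor_mk]
  | cons a x hx =>
    rw [braidThen_braidLetter_ι_mul, braidThen_braidLetter_ι_mul, ← hx,
      onFirstTwo_lTensor_lTensor, hσ.yang_baxter_tensor, LinearMap.lTensor_tmul]
  | add x y hx hy => simp only [map_add, LinearMap.add_apply, hx, hy]
  | smul r x hx => simp only [map_smul, LinearMap.smul_apply, hx]

theorem braidThen_braidThen_append (σ : A ⊗[K] A →ₗ[K] A ⊗[K] A)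
    (H : TensorAlgebra K A →ₗ[K] W →ₗ[K] V) (x : TensorAlgebra K A) (w : W)
    (t : A ⊗[K] A) :
    braidThen σ (braidThen σ H) x (((TensorProduct.mk K A W).flip w).lTensor A t) =
      ((H.flip w).lTensor A).lTensor A (braidThen σ (braidLetter σ) x t) :=
  braidThen_lTensor σ (fun x b => by simp [braidThen_tmul]) x t

/-- Moving a word past two letters commutes with braiding these two letters. -/
theorem IsBraiding.onFirstTwo_braidThen {σ : A ⊗[K] A →ₗ[K] A ⊗[K] A} (hσ : IsBraiding σ)
    (H : TensorAlgebra K A →ₗ[K] W →ₗ[K] V) (x : TensorAlgebra K A)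
    (t : A ⊗[K] (A ⊗[K] W)) :
    onFirstTwo σ V (braidThen σ (braidThen σ H) x t) =
      braidThen σ (braidThen σ H) x (onFirstTwo σ W t) := by
  refine LinearMap.congr_fun (f := onFirstTwo σ V ∘ₗ braidThen σ (braidThen σ H) x)
    (g := braidThen σ (braidThen σ H) x ∘ₗ onFirstTwo σ W) ?_ t
  ext b c w
  have e : b ⊗ₜ (c ⊗ₜ w) = ((TensorProduct.mk K A W).flip w).lTensor A (b ⊗ₜ[K] c) := by
    simp
  simp only [TensorProduct.AlgebraTensorModule.curry_apply, LinearMap.restrictScalars_self,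
    TensorProduct.curry_apply, LinearMap.comp_apply]
  rw [e, braidThen_braidThen_append, onFirstTwo_lTensor_lTensor,
    hσ.onFirstTwo_braidThen_braidLetter, onFirstTwo_lTensor_mk, braidThen_braidThen_append]

theorem braidLetter_cons (t : A ⊗[K] TensorAlgebra K A) (c : A) :
    braidLetter σ (cons K A t) c = (cons K A).lTensor A
      (onFirstTwo σ _ (((braidLetter σ).flip c).lTensor A t)) := by
  induction t with
  | zero => simp
  | tmul a x => simp [cons_tmul, braidLetter_ι_mul]
  | add s t hs ht => simp only [map_add, LinearMap.add_apply, hs, ht]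

end BraidThen

/-! ### The three operations and the compatibility of the braiding with the product -/

section Products

variable {K A : Type*} [CommRing K] [NonUnitalRing A] [Module K A] [IsScalarTower K A A]
  [SMulCommClass K A A] {W V : Type*} [AddCommGroup W] [Module K W] [AddCommGroup V]
  [Module K V] {σ : A ⊗[K] A →ₗ[K] A ⊗[K] A}

/-- `β (id ⊗ m) = (m ⊗ id) (id ⊗ β) (β ⊗ id)` on `T(A) ⊗ A ⊗ A`. -/
theorem IsBraidedAlgebra.braidLetter_mul (hσ : IsBraidedAlgebra σ) (x : TensorAlgebra K A)
    (t : A ⊗[K] A) :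
    braidLetter σ x (LinearMap.mul' K A t) =
      mulFirst K A (TensorAlgebra K A) (braidThen σ (braidLetter σ) x t) := by
  induction x using cons_induction with
  | one =>
    induction t with
    | zero => simp
    | tmul b c => simp [braidThen_one, braidLetter_one, mulFirst_tmul_tmul]
    | add s t hs ht => simp only [map_add, hs, ht]
  | cons a x hx =>
    have e : a ⊗ₜ[K] mulFirst K A (TensorAlgebra K A) (braidThen σ (braidLetter σ) x t) =
      (mulFirst K A (TensorAlgebra K A)).lTensor A
        (a ⊗ₜ[K] braidThen σ (braidLetter σ) x t) := by simp
    rw [braidThen_braidLetter_ι_mul, braidLetter_ι_mul, hx, mulFirst_lTensor_lTensor,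
      hσ.mul_right_tensor, e]
  | add x y hx hy => simp only [map_add, LinearMap.add_apply, hx, hy]
  | smul r x hx => simp only [map_smul, LinearMap.smul_apply, hx]

/-- Moving a word past two letters commutes with multiplying these two letters. -/
theorem IsBraidedAlgebra.mulFirst_braidThen (hσ : IsBraidedAlgebra σ)
    (H : TensorAlgebra K A →ₗ[K] W →ₗ[K] V) (x : TensorAlgebra K A)
    (t : A ⊗[K] (A ⊗[K] W)) :
    mulFirst K A V (braidThen σ (braidThen σ H) x t) =
      braidThen σ H x (mulFirst K A W t) := by
  refine LinearMap.congr_fun (f := mulFirst K A V ∘ₗ braidThen σ (braidThen σ H) x)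
    (g := braidThen σ H x ∘ₗ mulFirst K A W) ?_ t
  ext b c w
  have e : b ⊗ₜ (c ⊗ₜ w) = ((TensorProduct.mk K A W).flip w).lTensor A (b ⊗ₜ[K] c) := by
    simp
  simp only [TensorProduct.AlgebraTensorModule.curry_apply, LinearMap.restrictScalars_self,
    TensorProduct.curry_apply, LinearMap.comp_apply]
  rw [e, braidThen_braidThen_append, mulFirst_lTensor_lTensor, ← hσ.braidLetter_mul,
    LinearMap.mul'_apply, ← e, mulFirst_tmul_tmul, braidThen_tmul]

theorem prec_eq (x z : TensorAlgebra K A) :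
    prec σ x z = cons K A (((join σ).flip z).lTensor A (uncons K A x)) :=
  consMap_eq_cons_lTensor _ _

theorem succ_eq (x z : TensorAlgebra K A) :
    succ σ x z = cons K A (braidThen σ (join σ) x (uncons K A z)) := by
  have h : succAux σ x = cons K A ∘ₗ braidThen σ (join σ) x := by
    ext b y
    simp [succAux, braidThen_tmul, consMap_eq_cons_lTensor ((join σ).flip y)]
  exact LinearMap.congr_fun h _

theorem dot_eq (x z : TensorAlgebra K A) :
    dot σ x z = cons K A (mulFirst K A _
        (((braidThen σ (join σ)).flip (uncons K A z)).lTensor A (uncons K A x))) +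
      algebraMap K _ (TensorAlgebra.algebraMapInv x * TensorAlgebra.algebraMapInv z) := by
  have h : ∀ u t, dotAux σ u t =
      cons K A (mulFirst K A _ (((braidThen σ (join σ)).flip t).lTensor A u)) := by
    intro u t
    induction u with
    | zero => simp
    | add u u' hu hu' => simp only [map_add, LinearMap.add_apply, hu, hu']
    | tmul a x =>
      induction t with
      | zero => simp
      | add t t' ht ht' =>
        rw [map_add, ht, ht']
        simp
      | tmul b y =>
        rw [LinearMap.lTensor_tmul, LinearMap.flip_apply, braidThen_tmul, ← LinearMap.lTensor_tmul,
          mulFirst_lTensor_lTensor, mulFirst_tmul, ← mergeLetter_apply,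
          ← consMap_eq_cons_lTensor]
        simp [dotAux]
  simp [dot, h]

theorem uncons_prec (x z : TensorAlgebra K A) :
    uncons K A (prec σ x z) = ((join σ).flip z).lTensor A (uncons K A x) := by
  rw [prec_eq, uncons_cons]

theorem uncons_succ (x z : TensorAlgebra K A) :
    uncons K A (succ σ x z) = braidThen σ (join σ) x (uncons K A z) := by
  rw [succ_eq, uncons_cons]

theorem uncons_dot (x z : TensorAlgebra K A) :
    uncons K A (dot σ x z) = mulFirst K A _
      (((braidThen σ (join σ)).flip (uncons K A z)).lTensor A (uncons K A x)) := by
  rw [dot_eq, map_add, uncons_cons, Algebra.algebraMap_eq_smul_one, map_smul, uncons_one,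
    smul_zero, add_zero]

theorem algebraMapInv_prec (x z : TensorAlgebra K A) :
    TensorAlgebra.algebraMapInv (prec σ x z) = 0 := by
  rw [prec_eq, algebraMapInv_cons]

theorem algebraMapInv_succ (x z : TensorAlgebra K A) :
    TensorAlgebra.algebraMapInv (succ σ x z) = 0 := by
  rw [succ_eq, algebraMapInv_cons]

theorem algebraMapInv_dot (x z : TensorAlgebra K A) :
    TensorAlgebra.algebraMapInv (dot σ x z) =
      TensorAlgebra.algebraMapInv x * TensorAlgebra.algebraMapInv z := by
  rw [dot_eq, map_add, algebraMapInv_cons, zero_add]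
  exact TensorAlgebra.algebraMap_leftInverse A _

/-- The contribution of `≺` to `braidThen σ (join σ)` on a word `ax`. -/
theorem braidThen_prec_ι_mul (a : A) (x : TensorAlgebra K A)
    (t : A ⊗[K] TensorAlgebra K A) :
    braidThen σ (prec σ) (TensorAlgebra.ι K a * x) t =
      (cons K A).lTensor A (onFirstTwo σ _ (a ⊗ₜ braidThen σ (join σ) x t)) := by
  induction t with
  | zero => simp
  | tmul c z =>
    have h : (prec σ).flip z ∘ₗ cons K A = cons K A ∘ₗ ((join σ).flip z).lTensor A := by
      ext a x; simp [cons_tmul, cons_prec]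
    rw [braidThen_tmul, braidThen_tmul, braidLetter_ι_mul,
      ← LinearMap.lTensor_tmul A (((join σ).flip z).lTensor A), onFirstTwo_lTensor_lTensor]
    simpa only [LinearMap.lTensor_comp, LinearMap.comp_apply] using
      LinearMap.congr_fun (congrArg (LinearMap.lTensor A) h) _
  | add s t hs ht => simp only [map_add, TensorProduct.tmul_add, hs, ht]

theorem braidThen_succ_cons (x : TensorAlgebra K A)
    (t : A ⊗[K] (A ⊗[K] TensorAlgebra K A)) :
    braidThen σ (succ σ) x ((cons K A).lTensor A t) =
      (cons K A).lTensor A (braidThen σ (braidThen σ (join σ)) x t) :=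
  braidThen_lTensor σ (fun x w => by rw [succ_eq, uncons_cons]) x t

/-- The contribution of `·` to `braidThen σ (join σ)` on a word `ax`. -/
theorem braidThen_dot_ι_mul (a : A) (x : TensorAlgebra K A)
    (t : A ⊗[K] (A ⊗[K] TensorAlgebra K A)) :
    braidThen σ (dot σ) (TensorAlgebra.ι K a * x) ((cons K A).lTensor A t) =
      (cons K A).lTensor A ((mulFirst K A _).lTensor A
        (onFirstTwo σ _ (a ⊗ₜ braidThen σ (braidThen σ (join σ)) x t))) := by
  induction t with
  | zero => simp
  | tmul c w =>
    have h : (dot σ).flip (cons K A w) ∘ₗ cons K A =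
        cons K A ∘ₗ mulFirst K A _ ∘ₗ ((braidThen σ (join σ)).flip w).lTensor A := by
      refine LinearMap.ext fun u => ?_
      simp only [LinearMap.comp_apply, LinearMap.flip_apply, dot_eq, uncons_cons,
        algebraMapInv_cons, mul_zero, map_zero, add_zero]
    rw [LinearMap.lTensor_tmul, braidThen_tmul, braidThen_tmul, braidLetter_ι_mul,
      ← LinearMap.lTensor_tmul A (((braidThen σ (join σ)).flip w).lTensor A),
      onFirstTwo_lTensor_lTensor]
    simpa only [LinearMap.lTensor_comp, LinearMap.comp_apply] using
      LinearMap.congr_fun (congrArg (LinearMap.lTensor A) h) _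
  | add s t hs ht => simp only [map_add, TensorProduct.tmul_add, hs, ht]

theorem braidThen_join (x : TensorAlgebra K A) (t : A ⊗[K] TensorAlgebra K A) :
    braidThen σ (join σ) x t =
      braidThen σ (prec σ) x t + braidThen σ (succ σ) x t + braidThen σ (dot σ) x t := by
  have h : join σ = prec σ + succ σ + dot σ := by
    ext1 x; ext1 y; exact (prec_add_succ_add_dot σ x y).symm
  conv_lhs => rw [h]
  rw [braidThen_add, braidThen_add]

/-- The braiding is compatible with the quantum quasi-shuffle product:
`β (⋈ ⊗ id) = (id ⊗ ⋈) (β ⊗ id) (id ⊗ β)` on `T(A) ⊗ T(A) ⊗ A`. -/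
theorem IsBraidedAlgebra.braidLetter_join (hσ : IsBraidedAlgebra σ)
    (x y : TensorAlgebra K A) (c : A) :
    braidLetter σ (join σ x y) c = braidThen σ (join σ) x (braidLetter σ y c) := by
  induction y using cons_induction generalizing x c with
  | one =>
    have h : (join σ).flip 1 = LinearMap.id := by ext1 x; simp [join_one]
    rw [join_one, braidLetter_one, braidThen_tmul, h, LinearMap.lTensor_id_apply]
  | add y y' hy hy' => simp only [map_add, LinearMap.add_apply, hy, hy']
  | smul r y hy => simp only [map_smul, LinearMap.smul_apply, hy]
  | cons b y hy =>
    induction x using cons_induction with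
    | one =>
      have h : join σ 1 = LinearMap.id := by ext1 x; simp [one_join]
      rw [one_join, braidThen_one, h, LinearMap.lTensor_id_apply]
    | add x x' hx hx' => simp only [map_add, LinearMap.add_apply, hx, hx']
    | smul r x hx => simp only [map_smul, LinearMap.smul_apply, hx]
    | cons a x hx =>
      -- The hypothesis on `y` holds for all left factors, so it can be applied under `β`.
      have key : ∀ w : TensorAlgebra K A, ((braidLetter σ).flip c).lTensor A
          (braidThen σ (join σ) w (b ⊗ₜ y)) =
            braidThen σ (braidThen σ (join σ)) w (b ⊗ₜ braidLetter σ y c) := by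
        intro w
        have h : (braidLetter σ).flip c ∘ₗ (join σ).flip y =
            (braidThen σ (join σ)).flip (braidLetter σ y c) := by
          ext1 v; exact hy v c
        rw [braidThen_tmul, braidThen_tmul, ← LinearMap.comp_apply, ← LinearMap.lTensor_comp,
          h]
      rw [braidThen_join, ← prec_add_succ_add_dot, map_add, map_add, LinearMap.add_apply,
        LinearMap.add_apply]
      -- The summands of `⋈` match one by one; Yang-Baxter enters for `≻`, `mul_left` for `·`.
      congr 1
      · congr 1
        · rw [braidThen_prec_ι_mul, ← hx, cons_prec, braidLetter_ι_mul]
        · rw [succ_eq, uncons_ι_mul, braidLetter_cons, key, hσ.onFirstTwo_braidThen,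
            braidLetter_ι_mul, braidThen_succ_cons]
      · rw [braidLetter_ι_mul σ b c y, braidThen_dot_ι_mul, ← hσ.onFirstTwo_braidThen,
          ← LinearMap.lTensor_tmul, hσ.mul_left_tensor, ← key, dot_eq, uncons_ι_mul,
          uncons_ι_mul, ← cons_tmul a x, algebraMapInv_cons, zero_mul, map_zero, add_zero,
          braidLetter_cons, LinearMap.lTensor_tmul, LinearMap.flip_apply,
          ← mulFirst_lTensor_lTensor, LinearMap.lTensor_tmul]

end Products

/-! ### The tridendriform relations and associativity -/

section Relations

variable {K A : Type*} [CommRing K] [NonUnitalRing A] [Module K A] [IsScalarTower K A A]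
  [SMulCommClass K A A] {σ : A ⊗[K] A →ₗ[K] A ⊗[K] A}

theorem prec_prec_of_assoc (x y z : TensorAlgebra K A)
    (h : (((join σ).flip z) ∘ₗ ((join σ).flip y)).lTensor A (uncons K A x) =
      ((join σ).flip (join σ y z)).lTensor A (uncons K A x)) :
    prec σ (prec σ x y) z = prec σ x (join σ y z) := by
  rw [prec_eq, uncons_prec, prec_eq, ← h, LinearMap.lTensor_comp, LinearMap.comp_apply]

theorem succ_prec_of_assoc (x y z : TensorAlgebra K A)
    (h : ((join σ).flip z).lTensor A (braidThen σ (join σ) x (uncons K A y)) =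
      braidThen σ (join σ) x (((join σ).flip z).lTensor A (uncons K A y))) :
    prec σ (succ σ x y) z = succ σ x (prec σ y z) := by
  rw [prec_eq, uncons_succ, succ_eq, uncons_prec, h]

theorem star_succ_of_action (x y z : TensorAlgebra K A)
    (h : braidThen σ (join σ) (join σ x y) (uncons K A z) =
      braidThen σ (join σ) x (braidThen σ (join σ) y (uncons K A z))) :
    succ σ (join σ x y) z = succ σ x (succ σ y z) := by
  rw [succ_eq, succ_eq x, uncons_succ, h]

theorem IsBraidedAlgebra.succ_dot_of_action (hσ : IsBraidedAlgebra σ)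
    (x y z : TensorAlgebra K A)
    (h : ∀ x y, braidThen σ (join σ) (join σ x y) (uncons K A z) =
      braidThen σ (join σ) x (braidThen σ (join σ) y (uncons K A z))) :
    dot σ (succ σ x y) z = succ σ x (dot σ y z) := by
  have nat := braidThen_lTensor σ (H := join σ) (H' := braidThen σ (join σ))
    (f := (braidThen σ (join σ)).flip (uncons K A z))
    (g := (braidThen σ (join σ)).flip (uncons K A z)) fun x w => (h x w).symm
  rw [dot_eq, uncons_succ, succ_eq x (dot σ y z), uncons_dot, algebraMapInv_succ, zero_mul,
    map_zero, add_zero, ← hσ.mulFirst_braidThen, nat]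

theorem prec_dot_of_action (x y z : TensorAlgebra K A)
    (h : ∀ x, braidThen σ (join σ) (join σ x y) (uncons K A z) =
      braidThen σ (join σ) x (braidThen σ (join σ) y (uncons K A z))) :
    dot σ (prec σ x y) z = dot σ x (succ σ y z) := by
  have h' : (braidThen σ (join σ)).flip (uncons K A z) ∘ₗ (join σ).flip y =
      (braidThen σ (join σ)).flip (braidThen σ (join σ) y (uncons K A z)) := by
    ext1 x; exact h x
  rw [dot_eq, uncons_prec, dot_eq, uncons_succ, algebraMapInv_prec, algebraMapInv_succ,
    zero_mul, mul_zero, ← h', LinearMap.lTensor_comp, LinearMap.comp_apply]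

theorem dot_prec_of_assoc (x y z : TensorAlgebra K A)
    (h : ∀ x, ((join σ).flip z).lTensor A (braidThen σ (join σ) x (uncons K A y)) =
      braidThen σ (join σ) x (((join σ).flip z).lTensor A (uncons K A y))) :
    prec σ (dot σ x y) z = dot σ x (prec σ y z) := by
  have h' : ((join σ).flip z).lTensor A ∘ₗ (braidThen σ (join σ)).flip (uncons K A y) =
      (braidThen σ (join σ)).flip (((join σ).flip z).lTensor A (uncons K A y)) := by
    ext1 x; exact h x
  rw [prec_eq, uncons_dot, dot_eq, uncons_prec, algebraMapInv_prec, mul_zero, map_zero,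
    add_zero, ← mulFirst_lTensor_lTensor, ← h', LinearMap.lTensor_comp, LinearMap.comp_apply]

theorem IsBraidedAlgebra.dot_dot_of_action (hσ : IsBraidedAlgebra σ)
    (x y z : TensorAlgebra K A)
    (h : ∀ x y, braidThen σ (join σ) (join σ x y) (uncons K A z) =
      braidThen σ (join σ) x (braidThen σ (join σ) y (uncons K A z))) :
    dot σ (dot σ x y) z = dot σ x (dot σ y z) := by
  have nat := braidThen_lTensor σ (H := join σ) (H' := braidThen σ (join σ))
    (f := (braidThen σ (join σ)).flip (uncons K A z))
    (g := (braidThen σ (join σ)).flip (uncons K A z)) fun x w => (h x w).symm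
  have h' : (braidThen σ (join σ)).flip (uncons K A (dot σ y z)) =
      mulFirst K A _ ∘ₗ ((braidThen σ (join σ)).flip (uncons K A z)).lTensor A ∘ₗ
        (braidThen σ (join σ)).flip (uncons K A y) := by
    ext1 x
    simp only [LinearMap.comp_apply, LinearMap.flip_apply]
    rw [uncons_dot, ← hσ.mulFirst_braidThen, nat]
  rw [dot_eq, dot_eq x (dot σ y z), h', algebraMapInv_dot, algebraMapInv_dot, mul_assoc,
    uncons_dot, ← mulFirst_lTensor_lTensor, mulFirst_mulFirst, LinearMap.lTensor_comp,
    LinearMap.lTensor_comp]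
  rfl

theorem braidThen_lTensor_of_assoc (z : TensorAlgebra K A)
    (h : ∀ x y, join σ (join σ x y) z = join σ x (join σ y z)) (x : TensorAlgebra K A)
    (t : A ⊗[K] TensorAlgebra K A) :
    ((join σ).flip z).lTensor A (braidThen σ (join σ) x t) =
      braidThen σ (join σ) x (((join σ).flip z).lTensor A t) :=
  (braidThen_lTensor σ (fun x y => (h x y).symm) x t).symm

theorem IsBraidedAlgebra.braidThen_join_tmul (hσ : IsBraidedAlgebra σ) (c : A)
    (z : TensorAlgebra K A) (h : ∀ x y, join σ (join σ x y) z = join σ x (join σ y z))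
    (x y : TensorAlgebra K A) :
    braidThen σ (join σ) (join σ x y) (c ⊗ₜ z) =
      braidThen σ (join σ) x (braidThen σ (join σ) y (c ⊗ₜ z)) := by
  rw [braidThen_tmul, hσ.braidLetter_join, braidThen_lTensor_of_assoc z h,
    braidThen_tmul σ _ y]

theorem IsBraidedAlgebra.join_assoc (hσ : IsBraidedAlgebra σ) (x y z : TensorAlgebra K A) :
    join σ (join σ x y) z = join σ x (join σ y z) := by
  induction z using cons_induction generalizing x y with
  | one => simp only [join_one]
  | add z z' hz hz' => simp only [map_add, hz, hz']
  | smul r z hz => simp only [map_smul, hz]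
  | cons c z hz =>
    -- Action on `c ⊗ z`, from associativity with last factor `z`.
    have act : ∀ x y, braidThen σ (join σ) (join σ x y)
        (uncons K A (TensorAlgebra.ι K c * z)) = braidThen σ (join σ) x
          (braidThen σ (join σ) y (uncons K A (TensorAlgebra.ι K c * z))) := by
      rw [uncons_ι_mul]
      exact hσ.braidThen_join_tmul c z hz
    generalize TensorAlgebra.ι K c * z = Z at act
    induction y using cons_induction generalizing x with
    | one => simp only [join_one, one_join]
    | add y y' hy hy' => simp only [map_add, LinearMap.add_apply, hy, hy']
    | smul r y hy => simp only [map_smul, LinearMap.smul_apply, hy]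
    | cons b y hy =>
      -- Naturality at `b ⊗ y`, from associativity for the triples `(w, y, Z)`.
      have nat : ∀ x, ((join σ).flip Z).lTensor A
          (braidThen σ (join σ) x (uncons K A (TensorAlgebra.ι K b * y))) =
            braidThen σ (join σ) x
              (((join σ).flip Z).lTensor A (uncons K A (TensorAlgebra.ι K b * y))) := by
        intro x
        have h : (join σ).flip Z ∘ₗ (join σ).flip y = (join σ).flip (join σ y Z) := by
          ext1 w; exact hy w
        rw [uncons_ι_mul, LinearMap.lTensor_tmul, braidThen_tmul, braidThen_tmul,
          ← LinearMap.comp_apply, ← LinearMap.lTensor_comp, h, LinearMap.flip_apply]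
      generalize TensorAlgebra.ι K b * y = Y at nat
      induction x using cons_induction with
      | one => simp only [one_join]
      | add x x' hx hx' => simp only [map_add, LinearMap.add_apply, hx, hx']
      | smul r x hx => simp only [map_smul, LinearMap.smul_apply, hx]
      | cons a x hx =>
        have hp := prec_prec_of_assoc (σ := σ) (TensorAlgebra.ι K a * x) Y Z
          (by simp [uncons_ι_mul, hx])
        generalize TensorAlgebra.ι K a * x = X at hp
        -- Both sides are split so that their seven summands match by the seven relations.
        rw [← prec_add_succ_add_dot σ (join σ X Y) Z, star_succ_of_action X Y Z (act X Y),
          ← prec_add_succ_add_dot σ X Y, ← prec_add_succ_add_dot σ X (join σ Y Z), ← hp,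
          ← prec_add_succ_add_dot σ Y Z]
        simp only [map_add, LinearMap.add_apply]
        rw [succ_prec_of_assoc X Y Z (nat X), dot_prec_of_assoc X Y Z nat,
          hσ.succ_dot_of_action X Y Z act, prec_dot_of_action X Y Z fun x => act x Y,
          hσ.dot_dot_of_action X Y Z act]
        abel

/-- Under `braidThen σ (join σ)`, the algebra `(T(A), ⋈)` acts on `A ⊗ T(A)`. -/
theorem IsBraidedAlgebra.braidThen_join_join (hσ : IsBraidedAlgebra σ)
    (x y : TensorAlgebra K A) (t : A ⊗[K] TensorAlgebra K A) :
    braidThen σ (join σ) (join σ x y) t =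
      braidThen σ (join σ) x (braidThen σ (join σ) y t) := by
  induction t with
  | zero => simp
  | tmul c z => exact hσ.braidThen_join_tmul c z (fun x y => hσ.join_assoc x y z) x y
  | add s t hs ht => simp only [map_add, hs, ht]

theorem IsBraidedAlgebra.isTridendriform (hσ : IsBraidedAlgebra σ) :
    IsTridendriform (prec σ) (succ σ) (dot σ) where
  prec_prec x y z := by
    have h : (join σ).flip z ∘ₗ (join σ).flip y = (join σ).flip (join σ y z) := by
      ext1 w; exact hσ.join_assoc w y z
    rw [prec_add_succ_add_dot]
    exact prec_prec_of_assoc x y z (by rw [h])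
  succ_prec x y z := succ_prec_of_assoc x y z
    (braidThen_lTensor_of_assoc z (fun x y => hσ.join_assoc x y z) x _)
  star_succ x y z := by
    rw [prec_add_succ_add_dot]
    exact star_succ_of_action x y z (hσ.braidThen_join_join x y _)
  succ_dot x y z := hσ.succ_dot_of_action x y z fun x y => hσ.braidThen_join_join x y _
  prec_dot x y z := prec_dot_of_action x y z fun x => hσ.braidThen_join_join x y _
  dot_prec x y z := dot_prec_of_assoc x y z fun x =>
    braidThen_lTensor_of_assoc z (fun x y => hσ.join_assoc x y z) x _
  dot_dot x y z := hσ.dot_dot_of_action x y z fun x y => hσ.braidThen_join_join x y _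

end Relations

end QuantumQuasiShuffle

theorem theorem2p8 {K A : Type*} [Field K] [NonUnitalRing A] [Module K A]
    [IsScalarTower K A A] [SMulCommClass K A A]
    (σ : TensorProduct K A A →ₗ[K] TensorProduct K A A)
    (hσ : QuantumQuasiShuffle.IsBraidedAlgebra σ) :
    QuantumQuasiShuffle.IsTridendriform (QuantumQuasiShuffle.prec σ)
      (QuantumQuasiShuffle.succ σ) (QuantumQuasiShuffle.dot σ) :=
  hσ.isTridendriform
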